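/- Let $\mathbb F$ be an arbitrary field with algebraic closure $\overline{\mathbb F}$, and let $P(\lambda)\in\mathbb F[\lambda]^{m\times n}$ be a polynomial matrix of normal rank $r$ (its rank over $\mathbb F(\lambda)$), regarded as having grade $k$, i.e. all its entries have degree at most $k$. Then $$\delta_{fin}(P)+\delta_\infty(P)=kr+\delta^z(P)-\delta^p(P),$$ where the four numbers are defined as follows. *Eigenvalues.* The Smith form of $P$ is the unique matrix $U P V=\begin{bmatrix}\operatorname{diag}(d_1,\dots,d_r)&0\\0&0\end{bmatrix}$ with $U,V$ unimodular over $\mathbb F[\lambda]$, the $d_i$ monic and $d_i\mid d_{i+1}$. The partial multiplicities of $P$ at $\lambda_0\in\overline{\mathbb F}$ are the multiplicities of $\lambda_0$ as a root of $d_1,\dots,d_r$. The number of finite eigenvalues $\delta_{fin}(P)$ is the sum of all partial multiplicities at all $\lambda_0\in\overline{\mathbb F}$. The number of infinite eigenvalues $\delta_\infty(P)$ (which depends on $k$) is the sum of the partial multiplicities at $0$ of the reversal $\operatorname{rev}_kP(\lambda)=\lambda^kP(1/\lambda)$. *Poles and zeros.* Let $R(\lambda)\in\mathbb F(\lambda)^{m\times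 n}$ be a rational matrix of rank $r$. A square rational matrix is called regular at a point if it is invertible and neither it nor its inverse has an entry with a pole at that point (at $\infty$: both are proper). The structural indices of $R$ at $\lambda_0\in\overline{\mathbb F}$ are the unique integers $\sigma_1\le\dots\le\sigma_r$ such that $U R V=\begin{bmatrix}\operatorname{diag}((\lambda-\lambda_0)^{\sigma_1},\dots,(\lambda-\lambda_0)^{\sigma_r})&0\\0&0\end{bmatrix}$ for some square matrices $U,V$ over $\overline{\mathbb F}(\lambda)$ regular at $\lambda_0$. The structural indices of $R$ at $\infty$ are defined in the same way, with $(1/\lambda)^{\sigma_i}$ on the diagonal and $U,V$ over $\mathbb F(\lambda)$ regular at $\infty$. The zero degree $\delta^z(R)$ is the sum of all positive structural indices, and the pole degree (McMillan degree) $\delta^p(R)$ is the absolute value of the sum of all negative structural indices, both taken over all points of $\overline{\mathbb F}\cup\{\infty\}$. The numbers $\delta^z(P)$ and $\delta^p(P)$ are those of $P$ viewed as a rational matrix. -/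

import Mathlib

open Polynomial

noncomputable section

namespace PoleZero

/-- The `m × n` matrix with `d 0, …, d (r-1)` at the start of its main diagonal and zeros
elsewhere. -/
def rectDiag {R : Type*} [Zero R] (m n : ℕ) {r : ℕ} (d : Fin r → R) :
    Matrix (Fin m) (Fin n) R :=
  fun i j => if h : i.val = j.val ∧ i.val < r then d ⟨i.val, h.2⟩ else 0

section Polynomial

variable {F : Type*} [Field F] {m n : ℕ}

/-- A polynomial matrix viewed as a rational matrix. -/
def toRational (P : Matrix (Fin m) (Fin n) F[X]) : Matrix (Fin m) (Fin n) (RatFunc F) :=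
  P.map (algebraMap F[X] (RatFunc F))

/-- The normal rank: the rank over the field of rational functions. -/
def normalRank (P : Matrix (Fin m) (Fin n) F[X]) : ℕ := (toRational P).rank

/-- `P` can be regarded as a matrix polynomial of grade `k`: all entries have degree at
most `k`. -/
def HasGrade (k : ℕ) (P : Matrix (Fin m) (Fin n) F[X]) : Prop :=
  ∀ i j, (P i j).natDegree ≤ k

/-- The `k`-reversal `λ ^ k * P (1 / λ)` of a polynomial matrix of grade `k`. -/
def rev (k : ℕ) (P : Matrix (Fin m) (Fin n) F[X]) : Matrix (Fin m) (Fin n) F[X] :=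
  P.map (Polynomial.reflect k)

/-- `diag (d₁, …, d_r, 0)` is the Smith form of `P`. -/
def IsSmithForm (P : Matrix (Fin m) (Fin n) F[X]) {r : ℕ} (d : Fin r → F[X]) : Prop :=
  (∀ i, (d i).Monic) ∧ (∀ i j, i ≤ j → d i ∣ d j) ∧
  ∃ (U : Matrix (Fin m) (Fin m) F[X]) (V : Matrix (Fin n) (Fin n) F[X]),
    IsUnit U.det ∧ IsUnit V.det ∧ U * P * V = rectDiag m n d

/-- The invariant polynomials of `P`: the diagonal of its (unique) Smith form. -/
def invariantPolynomials (P : Matrix (Fin m) (Fin n) F[X]) : Fin (normalRank P) → F[X] :=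
  Classical.epsilon fun d => IsSmithForm P d

/-- The partial multiplicities of a polynomial matrix at `a`, a point of the algebraic
closure. They are all zero if `a` is not an eigenvalue. -/
def partialMultiplicity (P : Matrix (Fin m) (Fin n) F[X]) (a : AlgebraicClosure F)
    (i : Fin (normalRank P)) : ℕ :=
  ((invariantPolynomials P i).map (algebraMap F (AlgebraicClosure F))).rootMultiplicity a

/-- The number of finite eigenvalues: the sum of all partial multiplicities at all finite
points. -/
def numFiniteEigenvalues (P : Matrix (Fin m) (Fin n) F[X]) : ℕ :=
  ∑ᶠ a : AlgebraicClosure F, ∑ i, partialMultiplicity P a i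

/-- The number of infinite eigenvalues of `P` regarded as having grade `k`: the sum of the
partial multiplicities of the `k`-reversal at zero. -/
def numInfiniteEigenvalues (k : ℕ) (P : Matrix (Fin m) (Fin n) F[X]) : ℕ :=
  ∑ i, partialMultiplicity (rev k P) 0 i

end Polynomial

section Rational

variable {F : Type*} [Field F] {m n : ℕ}

/-- A rational function has no pole at the finite point `a`. -/
def NoPoleAt (a : F) (f : RatFunc F) : Prop := f.denom.eval a ≠ 0

/-- A rational function is proper: it has no pole at infinity. (The zero function has
`intDegree` equal to `0`.) -/
def IsProper (f : RatFunc F) : Prop := f.intDegree ≤ 0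

/-- A square rational matrix is regular at the finite point `a`: it is invertible and
neither it nor its inverse has a pole at `a`. -/
def RegularAt (a : F) (U : Matrix (Fin n) (Fin n) (RatFunc F)) : Prop :=
  U.det ≠ 0 ∧ (∀ i j, NoPoleAt a (U i j)) ∧ ∀ i j, NoPoleAt a (U⁻¹ i j)

/-- A square rational matrix is regular at infinity (biproper): it is invertible, and both
it and its inverse are proper. -/
def RegularAtInfinity (U : Matrix (Fin n) (Fin n) (RatFunc F)) : Prop :=
  U.det ≠ 0 ∧ (∀ i j, IsProper (U i j)) ∧ ∀ i j, IsProper (U⁻¹ i j)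

/-- `diag ((λ - a) ^ σ₁, …, (λ - a) ^ σ_r, 0)` is the local Smith–McMillan form of `R`
at the finite point `a`. -/
def IsLocalSmithMcMillan (R : Matrix (Fin m) (Fin n) (RatFunc F)) (a : F) {r : ℕ}
    (σ : Fin r → ℤ) : Prop :=
  Monotone σ ∧
  ∃ (U : Matrix (Fin m) (Fin m) (RatFunc F)) (V : Matrix (Fin n) (Fin n) (RatFunc F)),
    RegularAt a U ∧ RegularAt a V ∧
    U * R * V = rectDiag m n fun i => (RatFunc.X - RatFunc.C a) ^ σ i

/-- `diag ((1 / λ) ^ σ₁, …, (1 / λ) ^ σ_r, 0)` is the local Smith–McMillan form of `R`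
at infinity. -/
def IsLocalSmithMcMillanInfinity (R : Matrix (Fin m) (Fin n) (RatFunc F)) {r : ℕ}
    (σ : Fin r → ℤ) : Prop :=
  Monotone σ ∧
  ∃ (U : Matrix (Fin m) (Fin m) (RatFunc F)) (V : Matrix (Fin n) (Fin n) (RatFunc F)),
    RegularAtInfinity U ∧ RegularAtInfinity V ∧
    U * R * V = rectDiag m n fun i => (1 / RatFunc.X) ^ σ i

/-- The inclusion `F(λ) → K(λ)`, where `K` is the algebraic closure of `F`. -/
def ratFuncToClosure (F : Type*) [Field F] : RatFunc F →+* RatFunc (AlgebraicClosure F) :=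
  RatFunc.mapRingHom (Polynomial.mapRingHom (algebraMap F (AlgebraicClosure F)))
    (nonZeroDivisors_le_comap_nonZeroDivisors_of_injective _
      (Polynomial.map_injective _ (algebraMap F (AlgebraicClosure F)).injective))

/-- The structural indices of `R` at a finite point `a` of the algebraic closure `K` of `F`:
the exponents in the (unique) local Smith–McMillan form at `a`, formed over `K(λ)`, since
`λ - a` need not lie in `F(λ)`. -/
def structuralIndex (R : Matrix (Fin m) (Fin n) (RatFunc F)) (a : AlgebraicClosure F) :
    Fin R.rank → ℤ :=
  Classical.epsilon fun σ => IsLocalSmithMcMillan (R.map (ratFuncToClosure F)) a σ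

/-- The infinite structural indices of `R`: the exponents in the (unique) local
Smith–McMillan form at infinity. -/
def structuralIndexInfinity (R : Matrix (Fin m) (Fin n) (RatFunc F)) : Fin R.rank → ℤ :=
  Classical.epsilon fun σ => IsLocalSmithMcMillanInfinity R σ

/-- The number of finite zeros: the sum of all positive finite structural indices. -/
def numFiniteZeros (R : Matrix (Fin m) (Fin n) (RatFunc F)) : ℕ :=
  ∑ᶠ a : AlgebraicClosure F, ∑ i, (structuralIndex R a i).toNat

/-- The number of finite poles: the absolute value of the sum of all negative finite
structural indices. -/
def numFinitePoles (R : Matrix (Fin m) (Fin n) (RatFunc F)) : ℕ :=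
  ∑ᶠ a : AlgebraicClosure F, ∑ i, (-structuralIndex R a i).toNat

/-- The number of infinite zeros: the sum of all positive infinite structural indices. -/
def numInfiniteZeros (R : Matrix (Fin m) (Fin n) (RatFunc F)) : ℕ :=
  ∑ i, (structuralIndexInfinity R i).toNat

/-- The number of infinite poles: the absolute value of the sum of all negative infinite
structural indices. -/
def numInfinitePoles (R : Matrix (Fin m) (Fin n) (RatFunc F)) : ℕ :=
  ∑ i, (-structuralIndexInfinity R i).toNat

/-- The McMillan zero degree: the number of finite and infinite zeros. -/
def zeroDegree (R : Matrix (Fin m) (Fin n) (RatFunc F)) : ℕ :=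
  numFiniteZeros R + numInfiniteZeros R

/-- The McMillan (pole) degree: the number of finite and infinite poles. -/
def poleDegree (R : Matrix (Fin m) (Fin n) (RatFunc F)) : ℕ :=
  numFinitePoles R + numInfinitePoles R

end Rational

end PoleZero

end

/-! At a finite point `a` the Smith form of `P` is already a local Smith–McMillan form: each
invariant polynomial is a power of `λ - a` times a unit at `a`, and unimodular matrices are regular
there. The structural indices at `a` are therefore the partial multiplicities. They are nonnegative,
so the finite zeros are counted by `δ_fin` and there are no finite poles.

At infinity, `P(λ) = λ^k (rev_k P)(1/λ)`. Substituting `1/λ` into the Smith form of `rev_k P` turns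
unimodular matrices into biproper ones. If `μ_i` are the partial multiplicities of `rev_k P` at `0`,
the factor `λ^k` makes the indices of `P` at infinity `μ_i - k`. Hence infinite zeros minus infinite
poles equal `∑ (μ_i - k) = δ_∞ - kr`, and adding the finite contribution gives the identity.

The invariant polynomials and structural indices are defined by choice, so this needs existence of
the Smith form (`exists_isSmithForm`) and uniqueness of local exponents (`exponent_unique`).
Uniqueness of the Smith form itself is not needed. Finite points and infinity are treated together:
both are valuations on `F(λ)`, and `exists_biIntegral_rectDiag` passes from a unimodular
diagonalization to a local one. -/

namespace PoleZero

/-! ### Bordered matrices and unimodular equivalence -/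

section Bordered

variable {R : Type*} {m n : ℕ}

/-- The matrix with top left entry `a`, first row `b`, first column `c` and remaining block `D`. -/
def bordered (a : R) (b : Fin n → R) (c : Fin m → R) (D : Matrix (Fin m) (Fin n) R) :
    Matrix (Fin (m + 1)) (Fin (n + 1)) R :=
  Matrix.of (Fin.cons (Fin.cons a b) fun i => Fin.cons (c i) (D i))

@[simp] theorem bordered_zero_zero (a : R) (b : Fin n → R) (c : Fin m → R)
    (D : Matrix (Fin m) (Fin n) R) : bordered a b c D 0 0 = a := rfl

@[simp] theorem bordered_zero_succ (a : R) (b : Fin n → R) (c : Fin m → R)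
    (D : Matrix (Fin m) (Fin n) R) (j : Fin n) : bordered a b c D 0 j.succ = b j := rfl

@[simp] theorem bordered_succ_zero (a : R) (b : Fin n → R) (c : Fin m → R)
    (D : Matrix (Fin m) (Fin n) R) (i : Fin m) : bordered a b c D i.succ 0 = c i := rfl

@[simp] theorem bordered_succ_succ (a : R) (b : Fin n → R) (c : Fin m → R)
    (D : Matrix (Fin m) (Fin n) R) (i : Fin m) (j : Fin n) :
    bordered a b c D i.succ j.succ = D i j := rfl

end Bordered

section UnimodularEquivalence

variable {R : Type*} [CommRing R] {m n : ℕ}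

/-- Two matrices are equivalent if they differ by unimodular factors on both sides. -/
def UnimodularEquiv (P Q : Matrix (Fin m) (Fin n) R) : Prop :=
  ∃ (U : Matrix (Fin m) (Fin m) R) (V : Matrix (Fin n) (Fin n) R),
    IsUnit U.det ∧ IsUnit V.det ∧ U * P * V = Q

namespace UnimodularEquiv

theorem refl (P : Matrix (Fin m) (Fin n) R) : UnimodularEquiv P P :=
  ⟨1, 1, by simp, by simp, by simp⟩

theorem trans {P Q S : Matrix (Fin m) (Fin n) R} (h : UnimodularEquiv P Q)
    (h' : UnimodularEquiv Q S) : UnimodularEquiv P S := by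
  obtain ⟨U, V, hU, hV, rfl⟩ := h
  obtain ⟨U', V', hU', hV', rfl⟩ := h'
  refine ⟨U' * U, V * V', ?_, ?_, by simp only [Matrix.mul_assoc]⟩
  · rw [Matrix.det_mul]; exact hU'.mul hU
  · rw [Matrix.det_mul]; exact hV.mul hV'

theorem mul_left (P : Matrix (Fin m) (Fin n) R) {U : Matrix (Fin m) (Fin m) R}
    (hU : IsUnit U.det) : UnimodularEquiv P (U * P) :=
  ⟨U, 1, hU, by simp, by simp⟩

theorem mul_right (P : Matrix (Fin m) (Fin n) R) {V : Matrix (Fin n) (Fin n) R}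
    (hV : IsUnit V.det) : UnimodularEquiv P (P * V) :=
  ⟨1, V, by simp, hV, by simp⟩

theorem smul {P Q : Matrix (Fin m) (Fin n) R} (c : R) (h : UnimodularEquiv P Q) :
    UnimodularEquiv (c • P) (c • Q) := by
  obtain ⟨U, V, hU, hV, rfl⟩ := h
  exact ⟨U, V, hU, hV, by simp⟩

theorem unit_smul (P : Matrix (Fin m) (Fin n) R) {c : R} (hc : IsUnit c) :
    UnimodularEquiv P (c • P) := by
  refine ⟨c • 1, 1, ?_, by simp, by simp⟩
  rw [Matrix.det_smul, Matrix.det_one, mul_one]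
  exact hc.pow _

theorem submatrix_perm (P : Matrix (Fin m) (Fin n) R) (e : Equiv.Perm (Fin m))
    (f : Equiv.Perm (Fin n)) : UnimodularEquiv P (P.submatrix e f) := by
  refine ⟨e.toPEquiv.toMatrix, f.symm.toPEquiv.toMatrix, ?_, ?_, ?_⟩
  · have h := Matrix.det_permutation (R := R) e
    rw [Equiv.Perm.permMatrix] at h
    rw [h]
    exact (Equiv.Perm.sign e).isUnit.map (Int.castRingHom R)
  · have h := Matrix.det_permutation (R := R) f.symm
    rw [Equiv.Perm.permMatrix] at h
    rw [h]
    exact (Equiv.Perm.sign f.symm).isUnit.map (Int.castRingHom R)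
  · rw [PEquiv.toMatrix_toPEquiv_mul, PEquiv.mul_toMatrix_toPEquiv]
    simp

end UnimodularEquiv

theorem det_bordered_row_zero (a : R) (c : Fin m → R) (D : Matrix (Fin m) (Fin m) R) :
    (bordered a 0 c D).det = a * D.det := by
  rw [Matrix.det_succ_row_zero, Fin.sum_univ_succ]
  simp only [bordered_zero_zero, bordered_zero_succ, Pi.zero_apply, mul_zero, zero_mul,
    Finset.sum_const_zero, add_zero, Fin.val_zero, pow_zero, one_mul]
  rfl

theorem det_bordered_column_zero (a : R) (b : Fin m → R) (D : Matrix (Fin m) (Fin m) R) :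
    (bordered a b 0 D).det = a * D.det := by
  rw [Matrix.det_succ_column_zero, Fin.sum_univ_succ]
  simp only [bordered_zero_zero, bordered_succ_zero, Pi.zero_apply, mul_zero, zero_mul,
    Finset.sum_const_zero, add_zero, Fin.val_zero, pow_zero, one_mul]
  rfl

theorem bordered_mul_bordered_mul_bordered (U : Matrix (Fin m) (Fin m) R)
    (D : Matrix (Fin m) (Fin n) R) (V : Matrix (Fin n) (Fin n) R) :
    bordered 1 0 0 U * bordered 1 0 0 D * bordered 1 0 0 V = bordered 1 0 0 (U * D * V) := by
  ext i j
  refine Fin.cases ?_ (fun i => ?_) i <;> refine Fin.cases ?_ (fun j => ?_) j <;>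
    simp [Matrix.mul_apply, Fin.sum_univ_succ]

theorem UnimodularEquiv.bordered {D E : Matrix (Fin m) (Fin n) R} (h : UnimodularEquiv D E) :
    UnimodularEquiv (bordered 1 0 0 D) (PoleZero.bordered 1 0 0 E) := by
  obtain ⟨U, V, hU, hV, rfl⟩ := h
  refine ⟨PoleZero.bordered 1 0 0 U, PoleZero.bordered 1 0 0 V, ?_, ?_,
    bordered_mul_bordered_mul_bordered U D V⟩
  · rwa [det_bordered_row_zero, one_mul]
  · rwa [det_bordered_row_zero, one_mul]

/-- A corner entry `1` can be used to clear the first row and the first column. -/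
theorem exists_unimodularEquiv_bordered (M : Matrix (Fin (m + 1)) (Fin (n + 1)) R)
    (hM : M 0 0 = 1) : ∃ D : Matrix (Fin m) (Fin n) R, UnimodularEquiv M (bordered 1 0 0 D) := by
  refine ⟨Matrix.of fun i j => M i.succ j.succ - M i.succ 0 * M 0 j.succ,
    bordered 1 0 (fun i => -M i.succ 0) 1, bordered 1 (fun j => -M 0 j.succ) 0 1, ?_, ?_, ?_⟩
  · simp [det_bordered_row_zero]
  · simp [det_bordered_column_zero]
  · ext i j
    refine Fin.cases ?_ (fun i => ?_) i <;> refine Fin.cases ?_ (fun j => ?_) j <;>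
      simp [Matrix.mul_apply, Fin.sum_univ_succ, hM, Matrix.one_apply]
    ring

theorem bordered_rectDiag {r : ℕ} (d : Fin r → R) :
    bordered 1 0 0 (rectDiag m n d) = rectDiag (m + 1) (n + 1) (Fin.cons 1 d : Fin (r + 1) → R) := by
  ext i j
  refine Fin.cases ?_ (fun i => ?_) i <;> refine Fin.cases ?_ (fun j => ?_) j
  · simp [rectDiag]
  · simp [rectDiag]
  · simp [rectDiag]
  · simp only [bordered_succ_succ, rectDiag, Fin.val_succ, add_left_inj, add_lt_add_iff_right]
    rfl

theorem smul_rectDiag {r : ℕ} (c : R) (d : Fin r → R) :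
    c • rectDiag m n d = rectDiag m n fun i => c * d i := by
  ext i j
  simp only [Matrix.smul_apply, rectDiag, smul_eq_mul]
  split_ifs <;> simp

end UnimodularEquivalence

/-! ### Existence of the Smith form -/

section Euclidean

variable {R : Type*} [EuclideanDomain R] {m n : ℕ}

/-- Over a Euclidean domain a nonzero matrix is equivalent to a multiple of a matrix with corner
entry `1`. -/
theorem exists_unimodularEquiv_smul (P : Matrix (Fin (m + 1)) (Fin (n + 1)) R) (hP : P ≠ 0) :
    ∃ (g : R) (M : Matrix (Fin (m + 1)) (Fin (n + 1)) R),
      g ≠ 0 ∧ M 0 0 = 1 ∧ UnimodularEquiv P (g • M) := by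
  -- Take `g` minimal, in the Euclidean order, among the nonzero entries of all matrices equivalent
  -- to `P`. A nonzero remainder modulo `g` in its row or column would contradict minimality.
  let S : Set R := {g | g ≠ 0 ∧ ∃ Q, UnimodularEquiv P Q ∧ ∃ i j, Q i j = g}
  have hS : S.Nonempty := by
    obtain ⟨i, j, hij⟩ : ∃ i j, P i j ≠ 0 := by
      by_contra! h
      exact hP (Matrix.ext h)
    exact ⟨P i j, hij, P, .refl P, i, j, rfl⟩
  obtain ⟨g, ⟨hg, Q, hQ, i, j, hij⟩, hmin⟩ := EuclideanDomain.r_wellFounded.has_min S hS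
  have hcol : ∀ Q : Matrix (Fin (m + 1)) (Fin (n + 1)) R, UnimodularEquiv P Q → ∀ i j,
      Q i j = g → ∀ i', g ∣ Q i' j := by
    intro Q hQ i j hij i'
    rw [← EuclideanDomain.mod_eq_zero]
    by_contra h
    have hne : i' ≠ i := by rintro rfl; simp [hij] at h
    refine hmin (Q i' j % g) ⟨h, Matrix.transvection i' i (-(Q i' j / g)) * Q,
      hQ.trans (.mul_left Q (by simp [Matrix.det_transvection_of_ne _ _ hne])), i', j, ?_⟩
      (EuclideanDomain.mod_lt _ hg)
    rw [Matrix.transvection_mul_apply_same, hij, EuclideanDomain.mod_eq_sub_mul_div]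
    ring
  have hrow : ∀ Q : Matrix (Fin (m + 1)) (Fin (n + 1)) R, UnimodularEquiv P Q → ∀ i j,
      Q i j = g → ∀ j', g ∣ Q i j' := by
    intro Q hQ i j hij j'
    rw [← EuclideanDomain.mod_eq_zero]
    by_contra h
    have hne : j ≠ j' := by rintro rfl; simp [hij] at h
    refine hmin (Q i j' % g) ⟨h, Q * Matrix.transvection j j' (-(Q i j' / g)),
      hQ.trans (.mul_right Q (by simp [Matrix.det_transvection_of_ne _ _ hne])), i, j', ?_⟩
      (EuclideanDomain.mod_lt _ hg)
    rw [Matrix.mul_transvection_apply_same, hij, EuclideanDomain.mod_eq_sub_mul_div]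
    ring
  have hall : ∀ i' j', g ∣ Q i' j' := by
    intro i' j'
    by_cases hi : i' = i
    · exact hi ▸ hrow Q hQ i j hij j'
    obtain ⟨q, hq⟩ := hcol Q hQ i j hij i'
    -- The entry at `(i', j)` is `g * q`. Adding `1 - q` times row `i` makes it equal to `g`, so
    -- `hrow` applies to the new row `i'`, which differs from the old one by a multiple of `g`.
    have h := hrow (Matrix.transvection i' i (1 - q) * Q)
      (hQ.trans (.mul_left Q (by simp [Matrix.det_transvection_of_ne _ _ hi]))) i' j
      (by rw [Matrix.transvection_mul_apply_same, hij, hq]; ring) j'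
    rw [Matrix.transvection_mul_apply_same] at h
    exact (dvd_add_left ((hrow Q hQ i j hij j').mul_left _)).1 h
  choose M hM using hall
  refine ⟨g, (Matrix.of M).submatrix (Equiv.swap 0 i) (Equiv.swap 0 j), hg, ?_, ?_⟩
  · have := hM i j
    rw [hij] at this
    simpa using mul_left_cancel₀ hg (this.symm.trans (mul_one g).symm)
  · have hQM : Q = g • Matrix.of M := Matrix.ext hM
    have := UnimodularEquiv.submatrix_perm Q (Equiv.swap 0 i) (Equiv.swap 0 j)
    rw [hQM] at this hQ
    exact hQ.trans this

end Euclidean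

/-- Existence of the Smith form. -/
theorem exists_isSmithForm {F : Type*} [Field F] {m n : ℕ} (P : Matrix (Fin m) (Fin n) F[X]) :
    ∃ (r : ℕ) (d : Fin r → F[X]), r ≤ m ∧ r ≤ n ∧ IsSmithForm P d := by
  have hzero : ∀ {m n : ℕ}, ∃ (r : ℕ) (d : Fin r → F[X]), r ≤ m ∧ r ≤ n ∧
      IsSmithForm (0 : Matrix (Fin m) (Fin n) F[X]) d := by
    intro m n
    refine ⟨0, Fin.elim0, Nat.zero_le _, Nat.zero_le _, fun i => i.elim0, fun i => i.elim0,
      1, 1, by simp, by simp, ?_⟩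
    ext i j
    simp [rectDiag]
  induction m generalizing n with
  | zero => rw [Subsingleton.elim P 0]; exact hzero
  | succ m ih =>
    cases n with
    | zero => rw [Subsingleton.elim P 0]; exact hzero
    | succ n =>
      by_cases hP : P = 0
      · rw [hP]; exact hzero
      obtain ⟨g, M, hg, hM, hPM⟩ := exists_unimodularEquiv_smul P hP
      obtain ⟨D, hD⟩ := exists_unimodularEquiv_bordered M hM
      obtain ⟨r, d, hm, hn, hmonic, hdvd, hd⟩ := ih D
      -- Rescaling by a constant makes `g` monic. The diagonal becomes this monic polynomial times
      -- `1, d 0, d 1, …`, so the divisibility chain is inherited from `d`.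
      have hu : IsUnit (C g.leadingCoeff⁻¹) :=
        isUnit_C.2 (isUnit_iff_ne_zero.2 (inv_ne_zero (leadingCoeff_ne_zero.2 hg)))
      have hg' : (C g.leadingCoeff⁻¹ * g).Monic := by
        rw [mul_comm]; exact monic_mul_leadingCoeff_inv hg
      have hform := (hPM.trans (.unit_smul _ hu)).trans
        (.smul _ (.smul _ (hD.trans (.bordered hd))))
      rw [bordered_rectDiag, smul_rectDiag, smul_rectDiag] at hform
      refine ⟨r + 1, _, Nat.succ_le_succ hm, Nat.succ_le_succ hn, fun i => ?_, fun i j hij => ?_,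
        hform⟩
      · rw [← mul_assoc]
        refine hg'.mul (Fin.cases ?_ (fun i => ?_) i)
        · exact monic_one
        · exact hmonic i
      · refine mul_dvd_mul_left _ (mul_dvd_mul_left _ ?_)
        revert hij
        refine Fin.cases ?_ (fun i => ?_) i
        · simp
        · refine Fin.cases ?_ (fun j => ?_) j
          · intro h; simp at h
          · intro h; exact hdvd i j (Fin.succ_le_succ_iff.1 h)

/-! ### Local diagonal forms over a valued field -/

section Valuation

variable {K : Type*} [Field K] {Γ : Type*} [LinearOrderedCommGroupWithZero Γ]
  (v : Valuation K Γ) {m n r : ℕ}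

/-- A square matrix is biintegral for a valuation if it is invertible and both it and its inverse
have entries in the valuation ring. -/
def BiIntegral (U : Matrix (Fin n) (Fin n) K) : Prop :=
  U.det ≠ 0 ∧ (∀ i j, v (U i j) ≤ 1) ∧ ∀ i j, v (U⁻¹ i j) ≤ 1

variable {v}

theorem valuation_mul_apply_le_one {l : ℕ} {A : Matrix (Fin l) (Fin m) K}
    {B : Matrix (Fin m) (Fin n) K} (hA : ∀ i j, v (A i j) ≤ 1) (hB : ∀ i j, v (B i j) ≤ 1)
    (i : Fin l) (j : Fin n) : v ((A * B) i j) ≤ 1 := by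
  rw [Matrix.mul_apply]
  refine v.map_sum_le fun x _ => ?_
  rw [map_mul]
  exact mul_le_one' (hA i x) (hB x j)

theorem valuation_sign_mul_prod (U : Matrix (Fin n) (Fin n) K) (e : Equiv.Perm (Fin n)) :
    v (((Equiv.Perm.sign e : ℤ) : K) * ∏ i, U (e i) i) = ∏ i, v (U (e i) i) := by
  rw [map_mul, map_prod]
  rcases Int.units_eq_one_or (Equiv.Perm.sign e) with h | h <;> simp [h]

theorem valuation_det_le_one {U : Matrix (Fin n) (Fin n) K} (hU : ∀ i j, v (U i j) ≤ 1) :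
    v U.det ≤ 1 := by
  rw [Matrix.det_apply']
  refine v.map_sum_le fun e _ => ?_
  rw [valuation_sign_mul_prod]
  exact Finset.prod_le_one' fun i _ => hU _ _

/-- A block of small entries with `n - j` rows and `j + 1` columns makes the determinant small. -/
theorem valuation_det_lt_one {U : Matrix (Fin n) (Fin n) K} (hU : ∀ i j, v (U i j) ≤ 1)
    (j : Fin n) (hblock : ∀ i l, j ≤ i → l ≤ j → v (U i l) < 1) : v U.det < 1 := by
  rw [Matrix.det_apply']
  refine v.map_sum_lt one_ne_zero fun e _ => ?_
  rw [valuation_sign_mul_prod]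
  -- Pigeonhole: a permutation cannot send the `j + 1` columns `l ≤ j` into the `j` rows above row
  -- `j`, so every term of the determinant has a factor in the small block.
  obtain ⟨l, hl, hel⟩ : ∃ l, l ≤ j ∧ j ≤ e l := by
    by_contra! h
    have hcard := Finset.card_le_card_of_injOn e (s := Finset.Iic j) (t := Finset.Iio j)
      (fun l hl => by simpa using h l (by simpa using hl)) e.injective.injOn
    simp at hcard
  rw [← Finset.mul_prod_erase _ _ (Finset.mem_univ l)]
  exact mul_lt_one_of_lt_of_le (hblock _ _ hel hl) (Finset.prod_le_one' fun i _ => hU _ _)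

namespace BiIntegral

theorem isUnit_det {U : Matrix (Fin n) (Fin n) K} (hU : BiIntegral v U) : IsUnit U.det :=
  isUnit_iff_ne_zero.2 hU.1

theorem mul {U V : Matrix (Fin n) (Fin n) K} (hU : BiIntegral v U) (hV : BiIntegral v V) :
    BiIntegral v (U * V) := by
  refine ⟨?_, valuation_mul_apply_le_one hU.2.1 hV.2.1, ?_⟩
  · rw [Matrix.det_mul]
    exact mul_ne_zero hU.1 hV.1
  · rw [Matrix.mul_inv_rev]
    exact valuation_mul_apply_le_one hV.2.2 hU.2.2

theorem inv {U : Matrix (Fin n) (Fin n) K} (hU : BiIntegral v U) : BiIntegral v U⁻¹ := by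
  refine ⟨(Matrix.isUnit_nonsing_inv_det _ hU.isUnit_det).ne_zero, hU.2.2, ?_⟩
  rw [Matrix.nonsing_inv_nonsing_inv _ hU.isUnit_det]
  exact hU.2.1

/-- The determinants of `U` and `U⁻¹` both have value at most `1`, and their product is `1`. -/
theorem valuation_det {U : Matrix (Fin n) (Fin n) K} (hU : BiIntegral v U) : v U.det = 1 := by
  refine le_antisymm (valuation_det_le_one hU.2.1) ?_
  have h : v U.det * v U⁻¹.det = 1 := by
    rw [← map_mul, ← Matrix.det_mul, Matrix.mul_nonsing_inv _ hU.isUnit_det, Matrix.det_one,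
      map_one]
  rw [← h]
  exact mul_le_of_le_one_right' (valuation_det_le_one hU.2.2)

/-- The inverse of a unimodular matrix again has entries in `A`, so `φ` carries both into the
valuation ring. -/
theorem map {A : Type*} [CommRing A] (φ : A →+* K) (hφ : ∀ x, v (φ x) ≤ 1)
    {U : Matrix (Fin n) (Fin n) A} (hU : IsUnit U.det) : BiIntegral v (U.map φ) := by
  have hinv : (U.map φ)⁻¹ = U⁻¹.map φ := by
    refine Matrix.inv_eq_right_inv ?_
    rw [← Matrix.map_mul, Matrix.mul_nonsing_inv _ hU, Matrix.map_one _ φ.map_zero φ.map_one]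
  refine ⟨?_, fun i j => hφ _, fun i j => ?_⟩
  · have h := hU.map φ
    rw [RingHom.map_det] at h
    exact h.ne_zero
  · rw [hinv]
    exact hφ _

theorem diagonal {w : Fin n → K} (hw : ∀ i, v (w i) = 1) :
    BiIntegral v (Matrix.diagonal w) := by
  have hw0 : ∀ i, w i ≠ 0 := fun i h => by simpa [h] using hw i
  have hle : ∀ w : Fin n → K, (∀ i, v (w i) = 1) → ∀ i j, v (Matrix.diagonal w i j) ≤ 1 := by
    intro w hw i j
    rw [Matrix.diagonal_apply]
    split_ifs
    · exact (hw i).le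
    · simp
  have hinv : (Matrix.diagonal w)⁻¹ = Matrix.diagonal fun i => (w i)⁻¹ := by
    refine Matrix.inv_eq_right_inv ?_
    rw [Matrix.diagonal_mul_diagonal, ← Matrix.diagonal_one]
    exact congrArg _ (funext fun i => mul_inv_cancel₀ (hw0 i))
  refine ⟨?_, hle w hw, ?_⟩
  · rw [Matrix.det_diagonal]
    exact Finset.prod_ne_zero_iff.2 fun i _ => hw0 i
  · rw [hinv]
    exact hle _ fun i => by simp [hw i]

end BiIntegral

theorem mul_rectDiag_apply (hn : r ≤ n) (U : Matrix (Fin m) (Fin m) K) (hm : r ≤ m)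
    (d : Fin r → K) (i : Fin m) (j : Fin r) :
    (U * rectDiag m n d) i (j.castLE hn) = U i (j.castLE hm) * d j := by
  rw [Matrix.mul_apply, Finset.sum_eq_single (j.castLE hm)]
  · simp [rectDiag]
  · intro l _ hl
    rw [rectDiag, dif_neg, mul_zero]
    rintro ⟨h, -⟩
    exact hl (Fin.ext h)
  · simp

theorem rectDiag_mul_apply (hm : r ≤ m) (hn : r ≤ n) (V : Matrix (Fin n) (Fin n) K)
    (d : Fin r → K) (i : Fin r) (j : Fin n) :
    (rectDiag m n d * V) (i.castLE hm) j = d i * V (i.castLE hn) j := by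
  rw [Matrix.mul_apply, Finset.sum_eq_single (i.castLE hn)]
  · simp [rectDiag]
  · intro l _ hl
    rw [rectDiag, dif_neg, zero_mul]
    rintro ⟨h, -⟩
    exact hl (Fin.ext h.symm)
  · simp

theorem rectDiag_mul_apply_of_le (V : Matrix (Fin n) (Fin n) K) (d : Fin r → K) (i : Fin m)
    (hi : r ≤ i.val) (j : Fin n) : (rectDiag m n d * V) i j = 0 := by
  rw [Matrix.mul_apply]
  refine Finset.sum_eq_zero fun l _ => ?_
  rw [rectDiag, dif_neg, zero_mul]
  rintro ⟨-, h⟩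
  omega

/-- If `σ j < τ j`, then for `i ≥ j ≥ l` monotonicity gives `τ i > σ l`, and `U i l = π ^ (τ i - σ
l) * W i l` has value below `1`; in the rows `i ≥ r` it is zero. This block forces `v U.det < 1`,
contradicting biintegrality. -/
theorem exponent_le_of_mul_rectDiag_eq (hm : r ≤ m) (hn : r ≤ n) {π : K} (hπ : π ≠ 0)
    (hvπ : v π < 1) {σ τ : Fin r → ℤ} (hσ : Monotone σ) (hτ : Monotone τ)
    {U : Matrix (Fin m) (Fin m) K} {W : Matrix (Fin n) (Fin n) K} (hU : BiIntegral v U)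
    (hW : ∀ i j, v (W i j) ≤ 1)
    (h : U * rectDiag m n (fun i => π ^ σ i) = rectDiag m n (fun i => π ^ τ i) * W) (j : Fin r) :
    τ j ≤ σ j := by
  by_contra! hlt
  refine (valuation_det_lt_one hU.2.1 (j.castLE hm) fun i l hi hl => ?_).ne hU.valuation_det
  have hlr : l.val < r := lt_of_le_of_lt hl j.isLt
  have hentry := congrFun (congrFun h i) (Fin.castLE hn ⟨l, hlr⟩)
  rw [mul_rectDiag_apply hn U hm] at hentry
  change U i l * _ = _ at hentry
  by_cases hir : i.val < r
  · have hi' : i = Fin.castLE hm ⟨i, hir⟩ := rfl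
    rw [hi', rectDiag_mul_apply hm hn, ← hi'] at hentry
    have hexp : 0 < τ ⟨i, hir⟩ - σ ⟨l, hlr⟩ := by
      have h1 : τ j ≤ τ ⟨i, hir⟩ := hτ hi
      have h2 : σ ⟨l, hlr⟩ ≤ σ j := hσ hl
      omega
    have hUil : U i l = π ^ (τ ⟨i, hir⟩ - σ ⟨l, hlr⟩) *
        W (Fin.castLE hn ⟨i, hir⟩) (Fin.castLE hn ⟨l, hlr⟩) := by
      rw [zpow_sub₀ hπ]
      field_simp
      exact hentry
    rw [hUil, map_mul, map_zpow₀]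
    refine mul_lt_one_of_lt_of_le ?_ (hW _ _)
    obtain ⟨k, hk⟩ := Int.eq_ofNat_of_zero_le hexp.le
    rw [hk, zpow_natCast]
    exact pow_lt_one' hvπ (by omega)
  · rw [rectDiag_mul_apply_of_le W _ i (not_lt.1 hir)] at hentry
    have : U i l = 0 := (mul_eq_zero.1 hentry).resolve_right (zpow_ne_zero _ hπ)
    simp [this]

/-- Uniqueness of the exponents in a local Smith form. -/
theorem exponent_unique (hm : r ≤ m) (hn : r ≤ n) {π : K} (hπ : π ≠ 0) (hvπ : v π < 1)
    {σ τ : Fin r → ℤ} (hσ : Monotone σ) (hτ : Monotone τ) {R : Matrix (Fin m) (Fin n) K}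
    {U U' : Matrix (Fin m) (Fin m) K} {V V' : Matrix (Fin n) (Fin n) K}
    (hU : BiIntegral v U) (hV : BiIntegral v V) (hU' : BiIntegral v U') (hV' : BiIntegral v V')
    (h : U * R * V = rectDiag m n fun i => π ^ σ i)
    (h' : U' * R * V' = rectDiag m n fun i => π ^ τ i) : σ = τ := by
  -- Eliminating `R` gives `(U' * U⁻¹) * D_σ = D_τ * (V'⁻¹ * V)` for the two diagonal forms. The
  -- situation is symmetric, so one inequality applied twice suffices.
  have key : ∀ {σ τ : Fin r → ℤ}, Monotone σ → Monotone τ →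
      ∀ {U U' : Matrix (Fin m) (Fin m) K} {V V' : Matrix (Fin n) (Fin n) K},
      BiIntegral v U → BiIntegral v V → BiIntegral v U' → BiIntegral v V' →
      (U * R * V = rectDiag m n fun i => π ^ σ i) →
      (U' * R * V' = rectDiag m n fun i => π ^ τ i) → ∀ j, τ j ≤ σ j := by
    intro σ τ hσ hτ U U' V V' hU hV hU' hV' h h'
    refine exponent_le_of_mul_rectDiag_eq hm hn hπ hvπ hσ hτ (hU'.mul hU.inv)
      (hV'.inv.mul hV).2.1 ?_
    rw [← h, ← h']
    simp only [Matrix.mul_assoc]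
    rw [Matrix.nonsing_inv_mul_cancel_left _ _ hU.isUnit_det,
      Matrix.mul_nonsing_inv_cancel_left _ _ hV'.isUnit_det]
  exact funext fun j =>
    le_antisymm (key hτ hσ hU' hV' hU hV h' h j) (key hσ hτ hU hV hU' hV' h h' j)

theorem map_rectDiag {A B : Type*} [Zero A] [Zero B] (f : A → B) (hf : f 0 = 0) (d : Fin r → A) :
    (rectDiag m n d).map f = rectDiag m n fun i => f (d i) := by
  ext i j
  simp only [Matrix.map_apply, rectDiag]
  split_ifs <;> simp [hf]

/-- A unimodular diagonalization gives a local one, in which units are dropped. -/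
theorem exists_biIntegral_rectDiag {A : Type*} [CommRing A] (φ : A →+* K)
    (hφ : ∀ x, v (φ x) ≤ 1) {P : Matrix (Fin m) (Fin n) A} {d : Fin r → A}
    (h : UnimodularEquiv P (rectDiag m n d)) {u x : Fin r → K} (hu : ∀ i, v (u i) = 1)
    (hd : ∀ i, φ (d i) = x i * u i) :
    ∃ (U : Matrix (Fin m) (Fin m) K) (V : Matrix (Fin n) (Fin n) K),
      BiIntegral v U ∧ BiIntegral v V ∧ U * P.map φ * V = rectDiag m n x := by
  obtain ⟨U, V, hU, hV, hUV⟩ := h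
  -- The units `u` are padded with `1` to an `n × n` diagonal matrix, which is absorbed into the
  -- right factor.
  let w : Fin n → K := fun j => if h : j.val < r then u ⟨j, h⟩ else 1
  have hw : BiIntegral v (Matrix.diagonal w) := .diagonal fun i => by
    dsimp only [w]
    split_ifs
    · exact hu _
    · exact map_one v
  refine ⟨U.map φ, V.map φ * (Matrix.diagonal w)⁻¹, .map φ hφ hU,
    (BiIntegral.map φ hφ hV).mul hw.inv, ?_⟩
  rw [← Matrix.mul_assoc, ← Matrix.map_mul, ← Matrix.map_mul, hUV, map_rectDiag φ φ.map_zero]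
  have : (rectDiag m n fun i => φ (d i)) = rectDiag m n x * Matrix.diagonal w := by
    ext i j
    rw [Matrix.mul_diagonal]
    by_cases hij : i.val = j.val ∧ i.val < r
    · have hj : j.val < r := hij.1 ▸ hij.2
      have : (⟨i, hij.2⟩ : Fin r) = ⟨j, hj⟩ := Fin.ext hij.1
      simp only [rectDiag, dif_pos hij, hd, w, dif_pos hj, this]
    · simp only [rectDiag, dif_neg hij, zero_mul]
  rw [this, Matrix.mul_nonsing_inv_cancel_right _ _ hw.isUnit_det]

theorem rank_rectDiag (hm : r ≤ m) (hn : r ≤ n) {d : Fin r → K} (hd : ∀ i, d i ≠ 0) :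
    (rectDiag m n d).rank = r := by
  classical
  apply le_antisymm
  · have h := Matrix.rank_le_card_of_support_subset (rectDiag m n d)
      (Finset.univ.map (Fin.castLEEmb hm)) fun i hi => by
        by_contra hir
        refine hi (funext fun j => ?_)
        rw [Matrix.row, rectDiag, dif_neg]
        · rfl
        rintro ⟨-, h⟩
        exact hir (by simpa using h)
    simpa using h
  · have h := Matrix.rank_submatrix_le (rectDiag m n d) (Fin.castLE hm) (Fin.castLE hn)
    have hdiag : (rectDiag m n d).submatrix (Fin.castLE hm) (Fin.castLE hn) =
        Matrix.diagonal d := by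
      ext i j
      by_cases hij : i = j
      · subst hij
        simp [rectDiag]
      · simp [rectDiag, hij, Fin.val_inj]
    rw [hdiag, Matrix.rank_of_det_ne_zero, Fintype.card_fin] at h
    · exact h
    · rw [Matrix.det_diagonal]
      exact Finset.prod_ne_zero_iff.2 fun i _ => hd i

theorem rank_eq_of_mul_eq_rectDiag (hm : r ≤ m) (hn : r ≤ n) {R : Matrix (Fin m) (Fin n) K}
    {U : Matrix (Fin m) (Fin m) K} {V : Matrix (Fin n) (Fin n) K} (hU : U.det ≠ 0)
    (hV : V.det ≠ 0) {d : Fin r → K} (hd : ∀ i, d i ≠ 0) (h : U * R * V = rectDiag m n d) :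
    R.rank = r := by
  rw [← rank_rectDiag hm hn hd, ← h, Matrix.rank_mul_eq_left_of_det_ne_zero _ _ hV,
    Matrix.rank_mul_eq_right_of_det_ne_zero _ _ hU]

end Valuation

/-! ### The valuations of `F(λ)` at finite points and at infinity -/

variable {F : Type*} [Field F] {m n : ℕ}

section Places

/-- The valuation of `F(λ)` at the finite point `a`. -/
noncomputable def pointValuation (a : F) : Valuation (RatFunc F) (WithZero (Multiplicative ℤ)) :=
  IsDedekindDomain.HeightOneSpectrum.valuation (RatFunc F)
    { asIdeal := Ideal.span {X - C a}
      isPrime := (Ideal.span_singleton_prime (X_sub_C_ne_zero a)).2 (prime_X_sub_C a)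
      ne_bot := by simpa [Ideal.span_singleton_eq_bot] using X_sub_C_ne_zero a }

theorem pointValuation_algebraMap_le_one (a : F) (p : F[X]) :
    pointValuation a (algebraMap F[X] (RatFunc F) p) ≤ 1 :=
  IsDedekindDomain.HeightOneSpectrum.valuation_le_one _ p

theorem pointValuation_algebraMap_lt_one_iff (a : F) (p : F[X]) :
    pointValuation a (algebraMap F[X] (RatFunc F) p) < 1 ↔ p.eval a = 0 := by
  rw [pointValuation, IsDedekindDomain.HeightOneSpectrum.valuation_lt_one_iff_mem,
    Ideal.mem_span_singleton, dvd_iff_isRoot, IsRoot.def]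

theorem pointValuation_algebraMap_eq_one_iff (a : F) (p : F[X]) :
    pointValuation a (algebraMap F[X] (RatFunc F) p) = 1 ↔ p.eval a ≠ 0 := by
  rw [ne_eq, ← (pointValuation_algebraMap_lt_one_iff a p).not, not_lt]
  exact ⟨fun h => h.ge, fun h => le_antisymm (pointValuation_algebraMap_le_one a p) h⟩

theorem pointValuation_le_one_iff (a : F) (f : RatFunc F) :
    pointValuation a f ≤ 1 ↔ NoPoleAt a f := by
  have hf : pointValuation a f = pointValuation a (algebraMap F[X] (RatFunc F) f.num) /
      pointValuation a (algebraMap F[X] (RatFunc F) f.denom) := by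
    rw [← map_div₀, RatFunc.num_div_denom]
  constructor
  · intro h hden
    -- Numerator and denominator are coprime, so at a root of the denominator the numerator is a
    -- unit and `f` has value greater than `1`.
    have hnum : f.num.eval a ≠ 0 := by
      intro hnum
      obtain ⟨s, t, hst⟩ := f.isCoprime_num_denom
      have := congrArg (eval a) hst
      simp [hnum, hden] at this
    rw [← pointValuation_algebraMap_eq_one_iff] at hnum
    rw [hf, hnum, one_div, inv_le_one₀] at h
    · exact absurd ((pointValuation_algebraMap_lt_one_iff a _).2 hden) (not_lt.2 h)
    · rw [zero_lt_iff, (pointValuation a).ne_zero_iff]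
      simpa using f.denom_ne_zero
  · intro h
    rw [hf, (pointValuation_algebraMap_eq_one_iff a _).2 h, div_one]
    exact pointValuation_algebraMap_le_one a _

theorem regularAt_iff (a : F) (U : Matrix (Fin n) (Fin n) (RatFunc F)) :
    RegularAt a U ↔ BiIntegral (pointValuation a) U := by
  simp only [RegularAt, BiIntegral, pointValuation_le_one_iff]

open Classical in
/-- The valuation of `F(λ)` at infinity. -/
noncomputable def infinityValuation (F : Type*) [Field F] :
    Valuation (RatFunc F) (WithZero (Multiplicative ℤ)) :=
  RatFunc.inftyValuation F

theorem infinityValuation_le_one_iff (f : RatFunc F) :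
    infinityValuation F f ≤ 1 ↔ IsProper f := by
  classical
  rw [infinityValuation, RatFunc.inftyValuation_apply, RatFunc.inftyValuationDef, IsProper]
  split_ifs with h
  · simp [h]
  · rw [← WithZero.exp_zero, WithZero.exp_le_exp]

theorem regularAtInfinity_iff (U : Matrix (Fin n) (Fin n) (RatFunc F)) :
    RegularAtInfinity U ↔ BiIntegral (infinityValuation F) U := by
  simp only [RegularAtInfinity, BiIntegral, infinityValuation_le_one_iff]

theorem infinityValuation_one_div_X_lt_one :
    infinityValuation F (1 / RatFunc.X) < 1 := by
  rw [infinityValuation, RatFunc.inftyValuation.X_inv, ← WithZero.exp_zero, WithZero.exp_lt_exp]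
  norm_num

theorem infinityValuation_C_le_one (c : F) : infinityValuation F (RatFunc.C c) ≤ 1 := by
  rw [infinityValuation_le_one_iff, IsProper, RatFunc.intDegree_C]

theorem infinityValuation_C_eq_one {c : F} (hc : c ≠ 0) :
    infinityValuation F (RatFunc.C c) = 1 := by
  classical
  exact RatFunc.inftyValuation.C F hc

/-- The substitution `p(λ) ↦ p(1/λ)`. -/
noncomputable def evalOneDivX (F : Type*) [Field F] : F[X] →+* RatFunc F :=
  eval₂RingHom RatFunc.C (1 / RatFunc.X)

theorem evalOneDivX_C (c : F) : evalOneDivX F (C c) = RatFunc.C c := by simp [evalOneDivX]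

theorem evalOneDivX_X : evalOneDivX F X = 1 / RatFunc.X := by simp [evalOneDivX]

theorem infinityValuation_evalOneDivX_le_one (p : F[X]) :
    infinityValuation F (evalOneDivX F p) ≤ 1 := by
  induction p using Polynomial.induction_on' with
  | add p q hp hq =>
    rw [map_add]
    exact (infinityValuation F).map_add_le hp hq
  | monomial k c =>
    rw [← C_mul_X_pow_eq_monomial, map_mul, map_pow, evalOneDivX_C, evalOneDivX_X, map_mul, map_pow]
    exact mul_le_one' (infinityValuation_C_le_one c)
      (pow_le_one' infinityValuation_one_div_X_lt_one.le k)

/-- After substitution the nonzero constant term has value `1`, while the rest is a multiple of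
`1/λ` and is strictly smaller. -/
theorem infinityValuation_evalOneDivX_eq_one {p : F[X]} (hp : p.eval 0 ≠ 0) :
    infinityValuation F (evalOneDivX F p) = 1 := by
  have hC : infinityValuation F (evalOneDivX F (C (p.coeff 0))) = 1 := by
    rw [evalOneDivX_C]
    exact infinityValuation_C_eq_one (by rwa [coeff_zero_eq_eval_zero])
  rw [← divX_mul_X_add p, map_add, (infinityValuation F).map_add_eq_of_lt_right, hC]
  rw [hC, map_mul, map_mul, evalOneDivX_X, mul_comm]
  exact mul_lt_one_of_lt_of_le infinityValuation_one_div_X_lt_one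
    (infinityValuation_evalOneDivX_le_one _)

/-- This is the entrywise form of `P(λ) = λ^k (rev_k P)(1/λ)`, the source of the shift by `k` at
infinity. The degree bound ensures that `reflect k` reverses all the coefficients within degrees `0`
to `k`. -/
theorem evalOneDivX_reflect {k : ℕ} {p : F[X]} (hp : p.natDegree ≤ k) :
    RatFunc.X ^ k * evalOneDivX F (reflect k p) = algebraMap F[X] (RatFunc F) p := by
  let : Invertible (RatFunc.X : RatFunc F) := invertibleOfNonzero RatFunc.X_ne_zero
  have h := eval₂_reflect_mul_pow RatFunc.C (RatFunc.X : RatFunc F) k p hp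
  rw [invOf_eq_inv, ← one_div] at h
  rw [mul_comm, evalOneDivX, coe_eval₂RingHom, h, ← RatFunc.aeval_X_left_eq_algebraMap]
  rfl

end Places

/-! ### Structural indices of polynomial matrices -/

/-- The diagonal of a Smith form has as many entries as the normal rank. -/
theorem normalRank_eq_of_unimodularEquiv {P : Matrix (Fin m) (Fin n) F[X]} {r : ℕ} (hm : r ≤ m)
    (hn : r ≤ n) {d : Fin r → F[X]} (hd : ∀ i, d i ≠ 0)
    (h : UnimodularEquiv P (rectDiag m n d)) : normalRank P = r := by
  obtain ⟨U, V, hU, hV, hUV⟩ := h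
  have hdet : ∀ {l : ℕ} {W : Matrix (Fin l) (Fin l) F[X]}, IsUnit W.det →
      (W.map (algebraMap F[X] (RatFunc F))).det ≠ 0 := by
    intro l W hW
    have h := hW.map (algebraMap F[X] (RatFunc F))
    rw [RingHom.map_det] at h
    exact h.ne_zero
  refine rank_eq_of_mul_eq_rectDiag (d := fun i => algebraMap F[X] (RatFunc F) (d i)) hm hn
    (hdet hU) (hdet hV) (fun i => by simpa using hd i) ?_
  rw [toRational, ← Matrix.map_mul, ← Matrix.map_mul, hUV, map_rectDiag _ (map_zero _)]

/-- The existence theorem gives a diagonal of unspecified length; that length must be identified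
with the normal rank before the choice in `invariantPolynomials` is justified. -/
theorem isSmithForm_invariantPolynomials (P : Matrix (Fin m) (Fin n) F[X]) :
    IsSmithForm P (invariantPolynomials P) := by
  obtain ⟨r, d, hm, hn, hd⟩ := exists_isSmithForm P
  obtain rfl := normalRank_eq_of_unimodularEquiv hm hn (fun i => (hd.1 i).ne_zero) hd.2.2
  exact Classical.epsilon_spec (p := fun d => IsSmithForm P d) ⟨d, hd⟩

theorem normalRank_le_height (P : Matrix (Fin m) (Fin n) F[X]) : normalRank P ≤ m :=
  Matrix.rank_le_height _

theorem normalRank_le_width (P : Matrix (Fin m) (Fin n) F[X]) : normalRank P ≤ n :=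
  Matrix.rank_le_width _

theorem partialMultiplicity_monotone (P : Matrix (Fin m) (Fin n) F[X])
    (a : AlgebraicClosure F) : Monotone (partialMultiplicity P a) := by
  intro i j hij
  have h := isSmithForm_invariantPolynomials P
  exact rootMultiplicity_le_rootMultiplicity_of_dvd
    ((Polynomial.map_ne_zero_iff (algebraMap F (AlgebraicClosure F)).injective).2
      (h.1 j).ne_zero) (Polynomial.map_dvd _ (h.2.1 i j hij)) a

theorem ratFuncToClosure_algebraMap (p : F[X]) :
    ratFuncToClosure F (algebraMap F[X] (RatFunc F) p) =
      algebraMap _ _ (p.map (algebraMap F (AlgebraicClosure F))) := by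
  rw [ratFuncToClosure, RatFunc.coe_mapRingHom_eq_coe_map, RatFunc.map_apply]
  simp

theorem exists_eq_X_sub_C_pow_mul {p : F[X]} (hp : p ≠ 0) (a : F) :
    ∃ q : F[X], p = (X - C a) ^ p.rootMultiplicity a * q ∧ q.eval a ≠ 0 := by
  obtain ⟨q, hq, hdvd⟩ := p.exists_eq_pow_rootMultiplicity_mul_and_not_dvd hp a
  exact ⟨q, hq, fun h => hdvd (dvd_iff_isRoot.2 h)⟩

/-- Over the algebraic closure each invariant polynomial is a power of `λ - a` times a cofactor not
vanishing at `a`. The cofactors are units at `a` and can be dropped. -/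
theorem isLocalSmithMcMillan_partialMultiplicity (P : Matrix (Fin m) (Fin n) F[X])
    (a : AlgebraicClosure F) :
    IsLocalSmithMcMillan ((toRational P).map (ratFuncToClosure F)) a
      fun i => (partialMultiplicity P a i : ℤ) := by
  have h := isSmithForm_invariantPolynomials P
  choose q hq hqa using fun i => exists_eq_X_sub_C_pow_mul
    ((Polynomial.map_ne_zero_iff (algebraMap F (AlgebraicClosure F)).injective).2
      (h.1 i).ne_zero) a
  obtain ⟨U, V, hU, hV, hUV⟩ := exists_biIntegral_rectDiag (v := pointValuation a)
    ((algebraMap _ (RatFunc (AlgebraicClosure F))).comp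
      (mapRingHom (algebraMap F (AlgebraicClosure F))))
    (fun p => pointValuation_algebraMap_le_one a _) h.2.2
    (x := fun i => (RatFunc.X - RatFunc.C a) ^ (partialMultiplicity P a i : ℤ))
    (fun i => (pointValuation_algebraMap_eq_one_iff a (q i)).2 (hqa i)) fun i => by
      rw [RingHom.comp_apply, coe_mapRingHom, hq i, map_mul, map_pow, map_sub,
        RatFunc.algebraMap_X, RatFunc.algebraMap_C, zpow_natCast]
      rfl
  refine ⟨fun i j hij => Int.ofNat_le.2 (partialMultiplicity_monotone P a hij), U, V,
    (regularAt_iff a U).2 hU, (regularAt_iff a V).2 hV, ?_⟩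
  rw [← hUV]
  congr 2
  ext i j
  exact ratFuncToClosure_algebraMap _

theorem isLocalSmithMcMillan_unique {R : Matrix (Fin m) (Fin n) (RatFunc F)} {a : F} {r : ℕ}
    (hm : r ≤ m) (hn : r ≤ n) {σ τ : Fin r → ℤ} (hσ : IsLocalSmithMcMillan R a σ)
    (hτ : IsLocalSmithMcMillan R a τ) : σ = τ := by
  obtain ⟨hσ, U, V, hU, hV, h⟩ := hσ
  obtain ⟨hτ, U', V', hU', hV', h'⟩ := hτ
  rw [regularAt_iff] at hU hV hU' hV'
  have hX : algebraMap F[X] (RatFunc F) (X - C a) = RatFunc.X - RatFunc.C a := by simp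
  refine exponent_unique hm hn ?_ ?_ hσ hτ hU hV hU' hV' h h'
  · rw [← hX]
    simpa only [ne_eq, FaithfulSMul.algebraMap_eq_zero_iff] using X_sub_C_ne_zero a
  · rw [← hX, pointValuation_algebraMap_lt_one_iff]
    simp

theorem isLocalSmithMcMillanInfinity_unique {R : Matrix (Fin m) (Fin n) (RatFunc F)} {r : ℕ}
    (hm : r ≤ m) (hn : r ≤ n) {σ τ : Fin r → ℤ} (hσ : IsLocalSmithMcMillanInfinity R σ)
    (hτ : IsLocalSmithMcMillanInfinity R τ) : σ = τ := by
  obtain ⟨hσ, U, V, hU, hV, h⟩ := hσ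
  obtain ⟨hτ, U', V', hU', hV', h'⟩ := hτ
  rw [regularAtInfinity_iff] at hU hV hU' hV'
  exact exponent_unique hm hn (one_div_ne_zero RatFunc.X_ne_zero)
    infinityValuation_one_div_X_lt_one hσ hτ hU hV hU' hV' h h'

/-- The structural indices of a polynomial matrix at a finite point are its partial
multiplicities. -/
theorem structuralIndex_toRational (P : Matrix (Fin m) (Fin n) F[X]) (a : AlgebraicClosure F) :
    structuralIndex (toRational P) a = fun i => (partialMultiplicity P a i : ℤ) := by
  have h := isLocalSmithMcMillan_partialMultiplicity P a
  exact isLocalSmithMcMillan_unique (normalRank_le_height P) (normalRank_le_width P)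
    (Classical.epsilon_spec (p := fun σ : Fin (toRational P).rank → ℤ =>
      IsLocalSmithMcMillan ((toRational P).map (ratFuncToClosure F)) a σ) ⟨_, h⟩) h

/-- The Smith form of the reversal at zero gives the local Smith–McMillan form at infinity. -/
theorem isLocalSmithMcMillanInfinity_rev {k : ℕ} {P : Matrix (Fin m) (Fin n) F[X]}
    (hk : HasGrade k P) :
    IsLocalSmithMcMillanInfinity (toRational P)
      fun i => (partialMultiplicity (rev k P) 0 i : ℤ) - k := by
  have h := isSmithForm_invariantPolynomials (rev k P)
  choose q hq hq0 using fun i => exists_eq_X_sub_C_pow_mul (h.1 i).ne_zero 0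
  -- The form at infinity lives over `F`, whereas partial multiplicities are taken over the closure;
  -- the multiplicity of the root `0` is the same in both.
  have hmult : ∀ i, (invariantPolynomials (rev k P) i).rootMultiplicity 0 =
      partialMultiplicity (rev k P) 0 i := by
    intro i
    rw [partialMultiplicity, eq_rootMultiplicity_map (algebraMap F (AlgebraicClosure F)).injective,
      map_zero]
  obtain ⟨U, V, hU, hV, hUV⟩ := exists_biIntegral_rectDiag (v := infinityValuation F)
    (evalOneDivX F) infinityValuation_evalOneDivX_le_one h.2.2
    (x := fun i => (1 / RatFunc.X) ^ partialMultiplicity (rev k P) 0 i)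
    (fun i => infinityValuation_evalOneDivX_eq_one (hq0 i)) fun i => by
      rw [← hmult, ← evalOneDivX_X, ← map_pow, ← map_mul]
      conv_lhs => rw [hq i, C_0, sub_zero]
  refine ⟨fun i j hij => sub_le_sub_right
    (Int.ofNat_le.2 (partialMultiplicity_monotone (rev k P) 0 hij)) _, U, V,
    (regularAtInfinity_iff U).2 hU, (regularAtInfinity_iff V).2 hV, ?_⟩
  have hP : toRational P = (RatFunc.X ^ k : RatFunc F) • (rev k P).map (evalOneDivX F) := by
    ext1 i j
    exact (evalOneDivX_reflect (hk i j)).symm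
  rw [hP, Matrix.mul_smul, Matrix.smul_mul, hUV, smul_rectDiag]
  congr 1
  funext i
  -- The scalar `λ^k` is `(1/λ)^(-k)`, so it lowers every exponent by `k`.
  rw [zpow_sub₀ (one_div_ne_zero RatFunc.X_ne_zero), zpow_natCast, zpow_natCast, div_eq_mul_inv,
    mul_comm]
  simp

theorem rank_eq_of_isLocalSmithMcMillanInfinity {R : Matrix (Fin m) (Fin n) (RatFunc F)} {r : ℕ}
    (hm : r ≤ m) (hn : r ≤ n) {σ : Fin r → ℤ} (h : IsLocalSmithMcMillanInfinity R σ) :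
    R.rank = r := by
  obtain ⟨-, U, V, hU, hV, h⟩ := h
  exact rank_eq_of_mul_eq_rectDiag hm hn hU.1 hV.1
    (fun i => zpow_ne_zero _ (one_div_ne_zero RatFunc.X_ne_zero)) h

/-- The difference of the numbers of infinite zeros and poles is the sum of the exponents of the
local Smith–McMillan form at infinity. -/
theorem numInfiniteZeros_sub_numInfinitePoles {R : Matrix (Fin m) (Fin n) (RatFunc F)} {r : ℕ}
    (hm : r ≤ m) (hn : r ≤ n) {σ : Fin r → ℤ} (h : IsLocalSmithMcMillanInfinity R σ) :
    (numInfiniteZeros R : ℤ) - numInfinitePoles R = ∑ i, σ i := by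
  obtain rfl := rank_eq_of_isLocalSmithMcMillanInfinity hm hn h
  have hσ : structuralIndexInfinity R = σ :=
    isLocalSmithMcMillanInfinity_unique hm hn (Classical.epsilon_spec
      (p := fun σ : Fin R.rank → ℤ => IsLocalSmithMcMillanInfinity R σ) ⟨σ, h⟩) h
  rw [numInfiniteZeros, numInfinitePoles, hσ, Nat.cast_sum, Nat.cast_sum,
    ← Finset.sum_sub_distrib]
  -- An integer is its positive part minus its negative part.
  exact Finset.sum_congr rfl fun i _ => by omega

/-- The form at infinity of `P` built from `rev k P` has as many diagonal entries as the normal rank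
of the reversal, and this number is the rank of `P`. -/
theorem normalRank_rev {k : ℕ} {P : Matrix (Fin m) (Fin n) F[X]} (hk : HasGrade k P) :
    normalRank P = normalRank (rev k P) :=
  rank_eq_of_isLocalSmithMcMillanInfinity (normalRank_le_height _) (normalRank_le_width _)
    (isLocalSmithMcMillanInfinity_rev hk)

theorem numFiniteZeros_toRational (P : Matrix (Fin m) (Fin n) F[X]) :
    numFiniteZeros (toRational P) = numFiniteEigenvalues P := by
  simp only [numFiniteZeros, structuralIndex_toRational, Int.toNat_natCast]
  rfl

theorem numFinitePoles_toRational (P : Matrix (Fin m) (Fin n) F[X]) :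
    numFinitePoles (toRational P) = 0 := by
  simp [numFinitePoles, structuralIndex_toRational]

end PoleZero

theorem lemmaL {F : Type*} [Field F] {m n : ℕ} (k r : ℕ)
    (P : Matrix (Fin m) (Fin n) (Polynomial F)) (hk : PoleZero.HasGrade k P)
    (hr : PoleZero.normalRank P = r) :
    (PoleZero.numFiniteEigenvalues P : ℤ) + (PoleZero.numInfiniteEigenvalues k P : ℤ) =
      (k : ℤ) * (r : ℤ) + (PoleZero.zeroDegree (PoleZero.toRational P) : ℤ) -
        (PoleZero.poleDegree (PoleZero.toRational P) : ℤ) := by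
  open PoleZero in
  have h := numInfiniteZeros_sub_numInfinitePoles (normalRank_le_height _) (normalRank_le_width _)
    (isLocalSmithMcMillanInfinity_rev hk)
  have hr' : ((PoleZero.normalRank (PoleZero.rev k P) : ℕ) : ℤ) = r := by
    rw [← PoleZero.normalRank_rev hk, hr]
  -- The sum of `μ_i - k` has one term for each of the `r` indices of the reversal, so it
  -- contributes `-kr`.
  rw [Finset.sum_sub_distrib, Finset.sum_const, Finset.card_univ, Fintype.card_fin,
    nsmul_eq_mul, hr'] at h
  rw [PoleZero.zeroDegree, PoleZero.poleDegree, PoleZero.numFiniteZeros_toRational,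
    PoleZero.numFinitePoles_toRational, PoleZero.numInfiniteEigenvalues]
  push_cast at h ⊢
  linarith
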